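/- Let $E_k$ be the number of up-down permutations of $\{1,\dots,k\}$, i.e. permutations $a_1a_2\cdots a_k$ with $a_1<a_2>a_3<a_4>\cdots$; the numbers $E_{2n-1}$ are the tangent numbers. For a skew shape $\lambda/\mu$ let $f^{\lambda/\mu}$ be the number of standard Young tableaux of shape $\lambda/\mu$, i.e. of bijective fillings of its boxes with $1,2,\dots,|\lambda/\mu|$ that increase along rows (left to right) and along columns (top to bottom). For $n\ge 1$ let $$\sigma_{3n-2}=(n,n,n-1,n-2,\dots,3,2)/(n-2,n-3,\dots,1,0,0),$$ $$\sigma_{3n-1}=(n,n,n,n-1,n-2,\dots,3,2)/(n-1,n-2,\dots,1,0,0),$$ $$\sigma_{3n}=(n,n,n,n-1,\dots,3,2,1)/(n-1,n-2,\dots,1,0,0,0)$$ be the three $3$-strip shapes, with $3n-2$, $3n-1$ and $3n$ boxes respectively; the small cases are $\sigma_1=(1)$, $\sigma_2=(1,1)$, $\sigma_3=(1,1,1)$, $\sigma_4=(2,2)$, $\sigma_5=(2,2,2)/(1,0,0)$, $\sigma_6=(2,2,2,1)/(1,0,0,0)$. Then, for all $n\ge 1$, $$f^{\sigma_{3n-2}}=\frac{(3n-2)!\,E_{2n-1}}{(2n-1)!\,2^{2n-2}},\qquad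 f^{\sigma_{3n-1}}=\frac{(3n-1)!\,E_{2n-1}}{(2n-1)!\,2^{2n-1}},\qquad f^{\sigma_{3n}}=\frac{(3n)!\,(2^{2n-1}-1)\,E_{2n-1}}{(2n-1)!\,2^{2n-1}\,(2^{2n}-1)}.$$ Moreover, as formal power series over $\mathbb{Q}$, $$\sum_{n\ge 1}\frac{f^{\sigma_{3n-1}}}{(3n-1)!}\,x^{2n}=x\tan\left(\frac{x}{2}\right),\qquad \sum_{n\ge 1}\frac{f^{\sigma_{3n}}}{(3n)!}\,x^{2n}=\frac{x}{\sin x}-1.$$ -/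

import Mathlib

namespace ThreeStrip

/-- `w` is an up-down permutation: `w₁ < w₂ > w₃ < w₄ > ⋯`. Positions and values are indexed from
`0` here, so the ascents are at the even indices. -/
def IsUpDown {n : ℕ} (w : Equiv.Perm (Fin n)) : Prop :=
  ∀ (i : ℕ) (hi : i + 1 < n),
    (Even i → w ⟨i, Nat.lt_of_succ_lt hi⟩ < w ⟨i + 1, hi⟩) ∧
    (Odd i → w ⟨i + 1, hi⟩ < w ⟨i, Nat.lt_of_succ_lt hi⟩)

/-- The Euler number `E_n`: the number of up-down permutations of `n` letters. -/
noncomputable def eulerNumber (n : ℕ) : ℕ :=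
  Nat.card {w : Equiv.Perm (Fin n) // IsUpDown w}

/-- The boxes of the skew diagram `lam / mu`. The box `(i, j)` is in row `i` (counted from the top)
and in column `j` (counted from the left). -/
def skewCells (lam mu : YoungDiagram) : Finset (ℕ × ℕ) :=
  lam.cells \ mu.cells

/-- A bijective filling of a finite set `D` of boxes with `1, 2, …, |D|` is standard if it increases
along rows (from left to right) and along columns (from top to bottom). -/
def IsStandard (D : Finset (ℕ × ℕ)) (T : D ≃ Finset.Icc 1 D.card) : Prop :=
  (∀ a b : D, a.1.1 = b.1.1 → a.1.2 < b.1.2 → T a < T b) ∧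
  (∀ a b : D, a.1.2 = b.1.2 → a.1.1 < b.1.1 → T a < T b)

/-- `f^{lam / mu}`: the number of standard Young tableaux of skew shape `lam / mu`. -/
noncomputable def numSYT (lam mu : YoungDiagram) : ℕ :=
  Nat.card {T : skewCells lam mu ≃ Finset.Icc 1 (skewCells lam mu).card //
    IsStandard (skewCells lam mu) T}

/-- The list `a, a - 1, …, b + 1, b`, empty if `a < b`. -/
def down (a b : ℕ) : List ℕ := (List.range' b (a + 1 - b)).reverse

theorem mem_down {a b x : ℕ} : x ∈ down a b ↔ b ≤ x ∧ x ≤ a := by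
  simp only [down, List.mem_reverse, List.mem_range'_1]
  omega

theorem pairwise_down (a b : ℕ) : (down a b).Pairwise (· ≥ ·) := by
  rw [down, List.pairwise_reverse]
  exact (List.pairwise_lt_range' (s := b) (n := a + 1 - b)).imp fun h => le_of_lt h

theorem sorted_append_zeros (a k : ℕ) : (down a 1 ++ List.replicate k 0).SortedGE := by
  rw [List.sortedGE_iff_pairwise, List.pairwise_append]
  refine ⟨pairwise_down _ _, List.pairwise_replicate.2 (Or.inr le_rfl), ?_⟩
  intro x _ y hy
  rw [List.eq_of_mem_replicate hy]
  exact Nat.zero_le x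

theorem sorted_replicate_append (n k b : ℕ) : (List.replicate k n ++ down n b).SortedGE := by
  rw [List.sortedGE_iff_pairwise, List.pairwise_append]
  refine ⟨List.pairwise_replicate.2 (Or.inr le_rfl), pairwise_down _ _, ?_⟩
  intro x hx y hy
  rw [List.eq_of_mem_replicate hx]
  exact (mem_down.1 hy).2

/-- The partition with `k` parts `n`, followed by the parts `n, n - 1, …, b` (none if `n < b`). -/
def outerShape (k n b : ℕ) : YoungDiagram :=
  YoungDiagram.ofRowLens (List.replicate k n ++ down n b) (sorted_replicate_append n k b)

/-- The partition `(a, a - 1, …, 1, 0, …, 0)`, padded with `k` trailing zeros. -/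
def innerShape (a k : ℕ) : YoungDiagram :=
  YoungDiagram.ofRowLens (down a 1 ++ List.replicate k 0) (sorted_append_zeros a k)

/-- `f^{σ_{3n-2}}` for `n ≥ 1`, where
`σ_{3n-2} = (n, n, n-1, n-2, …, 3, 2) / (n-2, n-3, …, 1, 0, 0)`
(so `σ_1 = (1)` and `σ_4 = (2, 2)`). -/
noncomputable def fSigma2 (n : ℕ) : ℕ := numSYT (outerShape 1 n 2) (innerShape (n - 2) 2)

/-- `f^{σ_{3n-1}}` for `n ≥ 1`, where
`σ_{3n-1} = (n, n, n, n-1, n-2, …, 3, 2) / (n-1, n-2, …, 1, 0, 0)`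
(so `σ_2 = (1, 1)` and `σ_5 = (2, 2, 2) / (1, 0, 0)`). -/
noncomputable def fSigma1 (n : ℕ) : ℕ := numSYT (outerShape 2 n 2) (innerShape (n - 1) 2)

/-- `f^{σ_{3n}}` for `n ≥ 1`, where
`σ_{3n} = (n, n, n, n-1, …, 3, 2, 1) / (n-1, n-2, …, 1, 0, 0, 0)`
(so `σ_3 = (1, 1, 1)` and `σ_6 = (2, 2, 2, 1) / (1, 0, 0, 0)`). -/
noncomputable def fSigma0 (n : ℕ) : ℕ := numSYT (outerShape 2 n 1) (innerShape (n - 1) 3)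

/-- The formal power series `∑_{n ≥ 1} c n * x ^ (2 n)`. -/
noncomputable def evenSeries (c : ℕ → ℚ) : PowerSeries ℚ :=
  PowerSeries.mk fun k => if Even k ∧ 1 ≤ k then c (k / 2) else 0

end ThreeStrip

/-! The number of linear extensions of a poset with $N$ elements is $N!$ times the volume of its
order polytope (`card_linearExtensions`). A 3-strip consists of a middle antidiagonal and two outer
ones, and each outer box is related only to middle boxes, at most two of them and consecutive.
Integrating the outer coordinates out (`volume_sum_setOf_coord_lt`) leaves a chain integral over the
middle ones, that is, an iterate of the integral operator with kernel $\min(x,y)(1-\max(x,y))$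
(`lintegral_chain`). Up-down permutations of odd length give the kernel $1-\max(x,y)$ in the same
way.

Both kernels are Green's functions of $-d^2/dx^2$ on $[0,1]$: the first with Dirichlet conditions,
the second with a Neumann condition at $0$ and a Dirichlet condition at $1$. Hence $\sum_m t^{2m}K^m
q_0$ solves $u''=-t^2u$, and equals $\sin(tx)/\sin t$ for the first kernel with $q_0=x$, and
$\cos(tx)/\cos t$ for the second with $q_0=1$ (`integral_trigCoeff_mul_kernel`, coefficient by
coefficient). Integration over $x$ gives $\tan(t/2)/t$ for $\sigma_{3n-1}$ and $\tan(t)/t$ for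
$E_{2n-1}$; with the weight $1-x$ it gives $(t/\sin t-1)/t^2$ for $\sigma_{3n}$. For $\sigma_{3n-2}$
the start is $1=x+(1-x)$, and reflection symmetry doubles the value for $\sigma_{3n-1}$. The closed
formulas then compare coefficients by half- and double-angle identities. -/

namespace ThreeStrip

open MeasureTheory unitInterval

/-! ### Linear extensions and volumes of order polytopes -/

section LinearExtensions

set_option linter.unusedSectionVars false

variable {P L : Type*} [Fintype P] [Fintype L] [LinearOrder L]

theorem volume_setOf_coord_eq {a b : P} (h : a ≠ b) :
    volume {x : P → I | x a = x b} = 0 := by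
  classical
  have hind : ProbabilityTheory.iIndepFun (fun (i : P) (x : P → I) => x i) volume :=
    ProbabilityTheory.iIndepFun_pi (μ := fun _ : P => (volume : Measure I))
      (X := fun _ y => y) (fun _ => aemeasurable_id)
  have h2 := (ProbabilityTheory.indepFun_iff_map_prod_eq_prod_map_map
    (measurable_pi_apply a).aemeasurable (measurable_pi_apply b).aemeasurable).1 (hind.indepFun h)
  have ha : ∀ c : P, Measure.map (fun x : P → I => x c) volume = volume := fun c =>
    (measurePreserving_eval (fun _ : P => (volume : Measure I)) c).map_eq
  rw [ha a, ha b] at h2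
  have hm : MeasurableSet {p : I × I | p.1 = p.2} :=
    measurableSet_eq_fun measurable_fst measurable_snd
  have h3 : volume {x : P → I | x a = x b} =
      Measure.map (fun x : P → I => (x a, x b)) volume {p : I × I | p.1 = p.2} := by
    rw [Measure.map_apply (by fun_prop) hm]
    rfl
  rw [h3, h2, Measure.measure_prod_null hm]
  refine Filter.Eventually.of_forall fun x => ?_
  have : Prod.mk x ⁻¹' {p : I × I | p.1 = p.2} = {x} := by
    ext y
    simp [eq_comm]
  change volume (Prod.mk x ⁻¹' {p : I × I | p.1 = p.2}) = 0
  rw [this]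
  simp

/-- The points of the unit cube whose coordinates are ordered as prescribed by the labelling `T`. -/
def orderChamber (T : P ≃ L) : Set (P → I) := {x | ∀ a b, T a < T b → x a < x b}

theorem measurableSet_setOf_coord_lt (r : P → P → Prop) :
    MeasurableSet {x : P → I | ∀ a b, r a b → x a < x b} := by
  simp only [Set.ofPred_forall]
  exact MeasurableSet.iInter fun a => MeasurableSet.iInter fun b => MeasurableSet.iInter fun _ =>
    measurableSet_lt (measurable_pi_apply a) (measurable_pi_apply b)

theorem measurableSet_orderChamber (T : P ≃ L) : MeasurableSet (orderChamber T) :=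
  measurableSet_setOf_coord_lt fun a b => T a < T b

theorem volume_orderChamber_eq (T T' : P ≃ L) :
    volume (orderChamber T) = volume (orderChamber T') := by
  have h := volume_measurePreserving_piCongrLeft (fun _ : P => I) (T'.trans T.symm)
  rw [← h.measure_preimage (measurableSet_orderChamber T).nullMeasurableSet]
  congr 1
  ext x
  simp only [orderChamber, Set.mem_preimage, Set.mem_ofPred_eq]
  refine ((T'.trans T.symm).forall_congr fun a => ?_).symm
  refine (T'.trans T.symm).forall_congr fun b => ?_
  rw [MeasurableEquiv.coe_piCongrLeft, Equiv.piCongrLeft_apply_apply,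
    Equiv.piCongrLeft_apply_apply]
  simp

/-- A common point would make both labellings induce the same order on `P`, so they would differ by
an order automorphism of the finite chain `L`, which is trivial. -/
theorem disjoint_orderChamber {T T' : P ≃ L} (h : T ≠ T') :
    Disjoint (orderChamber T) (orderChamber T') := by
  rw [Set.disjoint_left]
  intro x hx hx'
  have key : ∀ a b, T a < T b ↔ T' a < T' b := by
    intro a b
    constructor
    · intro hab
      by_contra hn
      rcases (not_lt.1 hn).lt_or_eq with h1 | h1
      · exact lt_asymm (hx a b hab) (hx' b a h1)
      · rw [T'.injective h1] at hab
        exact lt_irrefl _ hab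
    · intro hab
      by_contra hn
      rcases (not_lt.1 hn).lt_or_eq with h1 | h1
      · exact lt_asymm (hx' a b hab) (hx b a h1)
      · rw [T.injective h1] at hab
        exact lt_irrefl _ hab
  apply h
  have hmono : StrictMono (T'.symm.trans T) := by
    intro u v huv
    simpa [key] using huv
  have hid : T'.symm.trans T = Equiv.refl L := by
    let e : L ≃o L := ⟨T'.symm.trans T, hmono.le_iff_le⟩
    have : e = OrderIso.refl L := Subsingleton.elim _ _
    ext u
    exact congrArg (fun f : L ≃o L => f u) this
  ext a
  have := congrArg (fun f : L ≃ L => f (T' a)) hid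
  simpa using this

theorem exists_mem_orderChamber (hcard : Fintype.card P = Fintype.card L) {x : P → I}
    (hx : Function.Injective x) : ∃ T : P ≃ L, x ∈ orderChamber T := by
  classical
  let s : Finset I := Finset.univ.image x
  have hs : s.card = Fintype.card P := Finset.card_image_of_injective _ hx
  let e₁ : P ≃ s := Equiv.ofBijective (fun a => ⟨x a, Finset.mem_image_of_mem _ (Finset.mem_univ a)⟩)
    ⟨fun a b h => hx (congrArg Subtype.val h), fun ⟨y, hy⟩ => by
      obtain ⟨a, -, rfl⟩ := Finset.mem_image.1 hy
      exact ⟨a, rfl⟩⟩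
  let e₂ : s ≃o L := (s.orderIsoOfFin hs).symm.trans (monoEquivOfFin L hcard.symm)
  refine ⟨e₁.trans e₂.toEquiv, fun a b hab => ?_⟩
  have : e₁ a < e₁ b := e₂.lt_iff_lt.1 hab
  exact this

theorem ae_injective : ∀ᵐ x : P → I, Function.Injective x := by
  have : ∀ᵐ x : P → I, ∀ a b : P, a ≠ b → x a ≠ x b := by
    rw [ae_all_iff]; intro a
    rw [ae_all_iff]; intro b
    by_cases h : a = b
    · simp [h]
    · have := volume_setOf_coord_eq h
      refine (ae_iff.2 ?_ : ∀ᵐ x : P → I, a ≠ b → x a ≠ x b)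
      simpa [h] using this
  filter_upwards [this] with x hx a b hab
  by_contra h
  exact hx a b h hab

-- Up to the null set of points with two equal coordinates, the polytope is the disjoint union of
-- the chambers of its linear extensions, and permuting coordinates shows that all chambers have the
-- same volume.
open Classical in
theorem volume_setOf_coord_lt_eq_card_mul (hcard : Fintype.card P = Fintype.card L)
    (r : P → P → Prop) (T₀ : P ≃ L) :
    volume {x : P → I | ∀ a b, r a b → x a < x b} =
      Nat.card {T : P ≃ L // ∀ a b, r a b → T a < T b} * volume (orderChamber T₀) := by
  let G : Finset (P ≃ L) := Finset.univ.filter fun T => ∀ a b, r a b → T a < T b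
  have h1 : volume {x : P → I | ∀ a b, r a b → x a < x b} =
      volume (⋃ T ∈ G, orderChamber T) := by
    apply measure_congr
    filter_upwards [ae_injective (P := P)] with x hx
    apply propext
    change (∀ a b, r a b → x a < x b) ↔ x ∈ ⋃ T ∈ G, orderChamber T
    simp only [Set.mem_iUnion, G, Finset.mem_filter, Finset.mem_univ, true_and, exists_prop]
    constructor
    · intro h
      obtain ⟨T, hT⟩ := exists_mem_orderChamber hcard hx
      refine ⟨T, fun a b hab => ?_, hT⟩
      by_contra hn
      rcases (not_lt.1 hn).lt_or_eq with h1 | h1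
      · exact lt_asymm (hT b a h1) (h a b hab)
      · have := h a b hab
        rw [T.injective h1] at this
        exact lt_irrefl _ this
    · rintro ⟨T, hT, hxT⟩ a b hab
      exact hxT a b (hT a b hab)
  rw [h1, measure_biUnion_finset (fun T _ T' _ h => disjoint_orderChamber h)
    (fun T _ => measurableSet_orderChamber T),
    Finset.sum_congr rfl (fun T _ => volume_orderChamber_eq T T₀), Finset.sum_const, nsmul_eq_mul,
    Nat.card_eq_fintype_card, Fintype.card_subtype]

/-- The number of linear extensions of a relation on a set with `N` elements is `N!` times the
volume of its order polytope. -/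
theorem card_linearExtensions (hcard : Fintype.card P = Fintype.card L) (r : P → P → Prop) :
    (Nat.card {T : P ≃ L // ∀ a b, r a b → T a < T b} : ENNReal) =
      (Fintype.card P).factorial * volume {x : P → I | ∀ a b, r a b → x a < x b} := by
  classical
  let T₀ : P ≃ L := Fintype.equivOfCardEq hcard
  -- The empty relation determines the volume of a chamber: its polytope is the whole cube, cut into
  -- $N!$ chambers.
  have h1 := volume_setOf_coord_lt_eq_card_mul hcard (fun _ _ => False) T₀
  have h2 : Nat.card {T : P ≃ L // ∀ a b, False → T a < T b} = (Fintype.card P).factorial := by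
    rw [← Fintype.card_equiv T₀, Nat.card_eq_fintype_card]
    exact Fintype.card_congr (Equiv.subtypeUnivEquiv fun T => by simp)
  rw [h2] at h1
  simp only [false_imp_iff, implies_true, Set.ofPred_true, measure_univ] at h1
  rw [volume_setOf_coord_lt_eq_card_mul hcard r T₀, mul_left_comm, ← h1, mul_one]

end LinearExtensions

/-! ### Integrating out the outer coordinates -/

section OrderPolytope

variable {M J : Type*} [Fintype M] [Fintype J]

/-- The volume of an order polytope in which the elements of `J` are only related to elements
of `M`, as an integral over the coordinates in `M`. -/
theorem volume_sum_setOf_coord_lt (r : M ⊕ J → M ⊕ J → Prop)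
    (hM : ∀ i i', ¬ r (.inl i) (.inl i')) (hJ : ∀ j j', ¬ r (.inr j) (.inr j')) :
    volume {x : M ⊕ J → I | ∀ a b, r a b → x a < x b} =
      ∫⁻ b : M → I, ∏ j, volume {y : I | (∀ i, r (.inr j) (.inl i) → y < b i) ∧
        (∀ i, r (.inl i) (.inr j) → b i < y)} := by
  have hmp := volume_measurePreserving_sumPiEquivProdPi_symm (fun _ : M ⊕ J => I)
  rw [← hmp.measure_preimage (measurableSet_setOf_coord_lt r).nullMeasurableSet]
  rw [Measure.volume_eq_prod, Measure.prod_apply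
    (hmp.measurable (measurableSet_setOf_coord_lt r))]
  refine lintegral_congr fun b => ?_
  rw [← volume_pi_pi]
  congr 1
  ext y
  simp only [Set.mem_preimage, Set.mem_ofPred_eq, Set.mem_pi, Set.mem_univ, forall_true_left,
    Sum.forall, hM, hJ, false_imp_iff, implies_true, true_and, and_true]
  constructor
  · rintro ⟨h1, h2⟩ j
    exact ⟨fun i h => h2 j i h, fun i h => h1 i j h⟩
  · intro h
    exact ⟨fun i j hr => (h j).2 i hr, fun j i hr => (h j).1 i hr⟩

end OrderPolytope

/-! ### Chain integrals as iterates of an integral operator -/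

section Transfer

/-- The integral operator with kernel `k`. -/
noncomputable def transfer (k : I → I → ENNReal) (g : I → ENNReal) (y : I) : ENNReal :=
  ∫⁻ x, g x * k x y

/-- Integrating over `x 0` first replaces the initial function `g` by `transfer k g` and shortens
the chain by one, which is why the induction generalizes `g`. -/
theorem lintegral_chain (k : I → I → ENNReal) (hk : Measurable (Function.uncurry k))
    (h : I → ENNReal) (hh : Measurable h) (m : ℕ) (g : I → ENNReal) (hg : Measurable g) :
    ∫⁻ x : Fin (m + 1) → I,
        g (x 0) * (∏ i : Fin m, k (x i.castSucc) (x i.succ)) * h (x (Fin.last m)) =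
      ∫⁻ y, (transfer k)^[m] g y * h y := by
  induction m generalizing g with
  | zero =>
    have := (volume_preserving_funUnique (Fin 1) I).lintegral_comp
      (f := fun y => g y * h y) (hg.mul hh)
    simp only [Finset.univ_eq_empty, Finset.prod_empty, mul_one, Function.iterate_zero, id_eq]
    convert this using 1
    congr!
  | succ m ih =>
    have hk' : ∀ {α : Type} [MeasurableSpace α] (f f' : α → I), Measurable f → Measurable f' →
        Measurable fun a => k (f a) (f' a) := fun f f' hf hf' => hk.comp (hf.prodMk hf')
    have hgk : Measurable (transfer k g) := by
      refine Measurable.lintegral_prod_left' (f := fun p : I × I => g p.1 * k p.1 p.2) ?_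
      exact (hg.comp measurable_fst).mul (hk' _ _ measurable_fst measurable_snd)
    rw [Function.iterate_succ_apply, ← ih _ hgk]
    let F : I × (Fin (m + 1) → I) → ENNReal := fun p =>
      g p.1 * k p.1 (p.2 0) * ((∏ i : Fin m, k (p.2 i.castSucc) (p.2 i.succ)) *
        h (p.2 (Fin.last m)))
    have hF₂ : Measurable fun y : Fin (m + 1) → I =>
        (∏ i : Fin m, k (y i.castSucc) (y i.succ)) * h (y (Fin.last m)) := by
      refine (Finset.measurable_prod _ fun i _ => hk' _ _ ?_ ?_).mul (hh.comp ?_) <;> fun_prop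
    have hF : Measurable F := by
      refine ((hg.comp measurable_fst).mul (hk' _ _ ?_ ?_)).mul (hF₂.comp measurable_snd) <;>
        fun_prop
    have h1 : ∀ x : Fin (m + 1 + 1) → I,
        g (x 0) * (∏ i : Fin (m + 1), k (x i.castSucc) (x i.succ)) * h (x (Fin.last (m + 1))) =
        F (MeasurableEquiv.piFinSuccAbove (fun _ => I) 0 x) := by
      intro x
      rw [Fin.prod_univ_succ]
      simp [F, MeasurableEquiv.piFinSuccAbove, mul_assoc]
      rfl
    simp_rw [h1]
    rw [(volume_preserving_piFinSuccAbove (fun _ : Fin (m + 1 + 1) => I) 0).lintegral_comp hF,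
      Measure.volume_eq_prod, lintegral_prod_symm' _ hF]
    refine lintegral_congr fun y => ?_
    simp only [F]
    have hgy : Measurable fun x => g x * k x (y 0) :=
      hg.mul (hk' _ _ measurable_id measurable_const)
    rw [lintegral_mul_const _ hgy, mul_assoc]
    rfl

end Transfer

/-! ### Standard tableaux as linear extensions of the adjacency relation -/

section Shapes

/-- The box `q` is the right or the lower neighbour of the box `p`. -/
def Adjacent (p q : ℕ × ℕ) : Prop :=
  (p.1 = q.1 ∧ p.2 + 1 = q.2) ∨ (p.2 = q.2 ∧ p.1 + 1 = q.1)

theorem mem_skewCells {lam mu : YoungDiagram} {p : ℕ × ℕ} :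
    p ∈ skewCells lam mu ↔ p ∈ lam ∧ p ∉ mu := by
  simp [skewCells]

/-- A skew diagram is convex for the product order, so two boxes in one row or column are joined by
a path of adjacent boxes inside it. With cover relations only, outer boxes of a strip interact
solely with the middle antidiagonal. -/
theorem isStandard_iff_adjacent (lam mu : YoungDiagram)
    (T : skewCells lam mu ≃ Finset.Icc 1 (skewCells lam mu).card) :
    IsStandard (skewCells lam mu) T ↔
      ∀ a b : skewCells lam mu, Adjacent a.1 b.1 → T a < T b := by
  constructor
  · rintro ⟨h1, h2⟩ a b (⟨h, h'⟩ | ⟨h, h'⟩)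
    · exact h1 a b h (by omega)
    · exact h2 a b h (by omega)
  · intro H
    have between : ∀ {p q x : ℕ × ℕ}, p ∈ skewCells lam mu → q ∈ skewCells lam mu →
        p ≤ x → x ≤ q → x ∈ skewCells lam mu := by
      intro p q x hp hq hpx hxq
      rw [mem_skewCells] at *
      exact ⟨lam.isLowerSet hxq hq.1, fun h => hp.2 (mu.isLowerSet hpx h)⟩
    have row : ∀ (d i j : ℕ) (h : (i, j) ∈ skewCells lam mu)
        (h' : (i, j + d + 1) ∈ skewCells lam mu), T ⟨_, h⟩ < T ⟨_, h'⟩ := by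
      intro d
      induction d with
      | zero => exact fun i j h h' => H _ _ (Or.inl ⟨rfl, rfl⟩)
      | succ d ih =>
        intro i j h h'
        have hx : (i, j + d + 1) ∈ skewCells lam mu :=
          between h h' ⟨le_rfl, by simp; omega⟩ ⟨le_rfl, by simp⟩
        exact (ih i j h hx).trans (H _ _ (Or.inl ⟨rfl, rfl⟩))
    have col : ∀ (d i j : ℕ) (h : (i, j) ∈ skewCells lam mu)
        (h' : (i + d + 1, j) ∈ skewCells lam mu), T ⟨_, h⟩ < T ⟨_, h'⟩ := by
      intro d
      induction d with
      | zero => exact fun i j h h' => H _ _ (Or.inr ⟨rfl, rfl⟩)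
      | succ d ih =>
        intro i j h h'
        have hx : (i + d + 1, j) ∈ skewCells lam mu :=
          between h h' ⟨by simp; omega, le_rfl⟩ ⟨by simp, le_rfl⟩
        exact (ih i j h hx).trans (H _ _ (Or.inr ⟨rfl, rfl⟩))
    constructor
    · rintro ⟨⟨i, j⟩, ha⟩ ⟨⟨i', j'⟩, hb⟩ h h'
      obtain rfl : i = i' := h
      obtain ⟨d, rfl⟩ := Nat.exists_eq_add_of_lt (show j < j' from h')
      exact row d i j ha hb
    · rintro ⟨⟨i, j⟩, ha⟩ ⟨⟨i', j'⟩, hb⟩ h h'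
      obtain rfl : j = j' := h
      obtain ⟨d, rfl⟩ := Nat.exists_eq_add_of_lt (show i < i' from h')
      exact col d i j ha hb

theorem numSYT_eq {Q : Type*} [Fintype Q] (lam mu : YoungDiagram) (pos : Q → ℕ × ℕ)
    (hinj : Function.Injective pos) (hpos : ∀ p, p ∈ skewCells lam mu ↔ ∃ a, pos a = p) :
    (numSYT lam mu : ENNReal) = (Fintype.card Q).factorial *
      volume {x : Q → I | ∀ a b, Adjacent (pos a) (pos b) → x a < x b} := by
  let e : Q ≃ skewCells lam mu := Equiv.ofBijective (fun a => ⟨pos a, (hpos _).2 ⟨a, rfl⟩⟩)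
    ⟨fun a b h => hinj (congrArg Subtype.val h), fun ⟨p, hp⟩ => by
      obtain ⟨a, rfl⟩ := (hpos p).1 hp
      exact ⟨a, rfl⟩⟩
  have hcard : Fintype.card Q = Fintype.card (Finset.Icc 1 (skewCells lam mu).card) := by
    rw [Fintype.card_congr e]
    simp
  rw [← card_linearExtensions hcard, numSYT]
  congr 1
  refine Nat.card_congr (Equiv.subtypeEquiv (e.equivCongr (Equiv.refl _)).symm fun T => ?_)
  rw [isStandard_iff_adjacent]
  refine (e.forall_congr fun a => e.forall_congr fun b => ?_).symm
  change (Adjacent (e a).1 (e b).1 → _) ↔ _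
  simp

theorem volume_setOf_lt_and_lt (u v : I) :
    volume {y : I | y < u ∧ y < v} = ENNReal.ofReal (min u v : I) := by
  have : {y : I | y < u ∧ y < v} = Set.Iio (min u v) := by ext y; simp
  rw [this, unitInterval.volume_Iio]

theorem volume_setOf_gt_and_gt (u v : I) :
    volume {y : I | u < y ∧ v < y} = ENNReal.ofReal (1 - (max u v : I)) := by
  have : {y : I | u < y ∧ v < y} = Set.Ioi (max u v) := by ext y; simp
  rw [this, unitInterval.volume_Ioi]

end Shapes

/-! ### The strip shapes and up-down permutations as chain integrals -/

theorem getElem_down {a b t : ℕ} (h : t < (down a b).length) : (down a b)[t] = a - t := by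
  simp only [down, List.length_reverse, List.length_range'] at h
  simp only [down, List.getElem_reverse, List.length_range', List.getElem_range']
  omega

theorem length_down (a b : ℕ) : (down a b).length = a + 1 - b := by simp [down]

theorem mem_outerShape {k n b i j : ℕ} : (i, j) ∈ outerShape k n b ↔
    i < k + (n + 1 - b) ∧ j < n - (i - k) := by
  rw [outerShape, YoungDiagram.mem_ofRowLens]
  simp only [List.getElem_append, List.length_append, List.length_replicate, length_down,
    List.getElem_replicate, getElem_down, exists_prop]
  refine and_congr_right fun _ => ?_
  split_ifs with h
  · rw [Nat.sub_eq_zero_of_le h.le, Nat.sub_zero]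
  · rfl

theorem mem_innerShape {a k i j : ℕ} : (i, j) ∈ innerShape a k ↔ i + j < a := by
  rw [innerShape, YoungDiagram.mem_ofRowLens]
  simp only [List.getElem_append, List.length_append, List.length_replicate, length_down,
    List.getElem_replicate, getElem_down, exists_prop]
  split_ifs with h <;> omega

/-- The volume of the pairs of coordinates `a`, `c` with `a < x, y < c`. -/
noncomputable def stripKernel (x y : I) : ENNReal :=
  ENNReal.ofReal (min x y : I) * ENNReal.ofReal (1 - (max x y : I))

theorem measurable_stripKernel : Measurable (Function.uncurry stripKernel) := by
  unfold stripKernel Function.uncurry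
  fun_prop

/-- The volume of the coordinates `c` with `x, y < c`. -/
noncomputable def peakKernel (x y : I) : ENNReal :=
  ENNReal.ofReal (1 - (max x y : I))

theorem measurable_peakKernel : Measurable (Function.uncurry peakKernel) := by
  unfold peakKernel Function.uncurry
  fun_prop

theorem volume_setOf_forall_lt_pair {m : ℕ} (b : Fin (m + 1) → I) (j : Fin m) (p : Fin (m + 1) → Prop)
    (hp : ∀ i, p i ↔ i = j.castSucc ∨ i = j.succ) :
    volume {y : I | ∀ i, p i → y < b i} = ENNReal.ofReal (min (b j.castSucc) (b j.succ) : I) := by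
  rw [← volume_setOf_lt_and_lt]
  simp [hp, or_imp, forall_and]

theorem volume_setOf_forall_gt_pair {m : ℕ} (b : Fin (m + 1) → I) (j : Fin m) (p : Fin (m + 1) → Prop)
    (hp : ∀ i, p i ↔ i = j.castSucc ∨ i = j.succ) :
    volume {y : I | ∀ i, p i → b i < y} =
      ENNReal.ofReal (1 - (max (b j.castSucc) (b j.succ) : I)) := by
  rw [← volume_setOf_gt_and_gt]
  simp [hp, or_imp, forall_and]

theorem volume_setOf_forall_lt_single {m : ℕ} (b : Fin (m + 1) → I) (j : Fin (m + 1)) (p : Fin (m + 1) → Prop)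
    (hp : ∀ i, p i ↔ i = j) :
    volume {y : I | ∀ i, p i → y < b i} = ENNReal.ofReal (b j) := by
  have : {y : I | ∀ i, p i → y < b i} = Set.Iio (b j) := by ext; simp [hp]
  rw [this, unitInterval.volume_Iio]

theorem volume_setOf_forall_gt_single {m : ℕ} (b : Fin (m + 1) → I) (j : Fin (m + 1)) (p : Fin (m + 1) → Prop)
    (hp : ∀ i, p i ↔ i = j) :
    volume {y : I | ∀ i, p i → b i < y} = ENNReal.ofReal (1 - b j) := by
  have : {y : I | ∀ i, p i → b i < y} = Set.Ioi (b j) := by ext; simp [hp]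
  rw [this, unitInterval.volume_Ioi]

theorem fSigma2_eq (m : ℕ) : (fSigma2 (m + 1) : ENNReal) =
    (3 * m + 1).factorial * ∫⁻ y, (transfer stripKernel)^[m] (fun _ => 1) y * 1 := by
  -- The antidiagonals $i+j=m$ (middle), $m-1$ and $m+1$. Outer boxes number `k` lie before,
  -- respectively after, the middle boxes `k` and `k + 1`; each such pair of outer boxes contributes
  -- one factor `stripKernel`.
  let pos : Fin (m + 1) ⊕ (Fin m ⊕ Fin m) → ℕ × ℕ :=
    Sum.elim (fun i => (i, m - i)) (Sum.elim (fun k => (k, m - 1 - k)) fun k => (k + 1, m - k))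
  rw [fSigma2, numSYT_eq _ _ pos, volume_sum_setOf_coord_lt]
  · rw [← lintegral_chain _ measurable_stripKernel _ (by fun_prop) m _ (by fun_prop)]
    congr 1
    · congr 2
      simp
      omega
    · refine lintegral_congr fun b => ?_
      rw [Fintype.prod_sum_type, ← Finset.prod_mul_distrib, one_mul, mul_one]
      refine Finset.prod_congr rfl fun j _ => ?_
      have hj := j.2
      rw [stripKernel]
      congr 1
      · rw [← volume_setOf_forall_lt_pair b j
          (fun i => Adjacent (pos (.inr (.inl j))) (pos (.inl i)))]
        · congr 1
          ext y
          simp only [Set.mem_ofPred_eq, and_iff_left_iff_imp]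
          intro _ i h
          simp [pos, Adjacent] at h
          omega
        · intro i
          simp [pos, Adjacent, Fin.ext_iff]
          omega
      · rw [← volume_setOf_forall_gt_pair b j
          (fun i => Adjacent (pos (.inl i)) (pos (.inr (.inr j))))]
        · congr 1
          ext y
          simp only [Set.mem_ofPred_eq, and_iff_right_iff_imp]
          intro _ i h
          simp [pos, Adjacent] at h
          omega
        · intro i
          simp [pos, Adjacent, Fin.ext_iff]
          omega
  · intro i j
    simp [pos, Adjacent]
    omega
  · rintro (i | i) (j | j) <;> simp [pos, Adjacent] <;> omega
  · rintro (i | i | i) (j | j | j) <;> simp [pos, Fin.ext_iff] <;> omega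
  · rintro ⟨i, j⟩
    rw [mem_skewCells, mem_outerShape, mem_innerShape]
    simp only [Sum.exists, pos, Sum.elim_inl, Sum.elim_inr, Prod.mk.injEq]
    constructor
    · intro h
      rcases (by omega : i + j + 1 = m ∨ i + j = m ∨ i + j = m + 1) with h1 | h1 | h1
      · exact Or.inr (Or.inl ⟨⟨i, by omega⟩, rfl, by simp; omega⟩)
      · exact Or.inl ⟨⟨i, by omega⟩, rfl, by simp; omega⟩
      · exact Or.inr (Or.inr ⟨⟨i - 1, by omega⟩, by simp; omega, by simp; omega⟩)
    · rintro (⟨a, rfl, rfl⟩ | ⟨a, rfl, rfl⟩ | ⟨a, rfl, rfl⟩) <;> omega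

theorem fSigma1_eq (m : ℕ) : (fSigma1 (m + 1) : ENNReal) =
    (3 * m + 2).factorial *
      ∫⁻ y, (transfer stripKernel)^[m] (fun x => ENNReal.ofReal x) y * 1 := by
  -- The middle antidiagonal is now $i+j=m+1$. The upper one has an extra box $(0,m)$, lying only
  -- above middle box `0`; its coordinate has volume $x_0$, which is the initial function.
  let pos : Fin (m + 1) ⊕ (Fin (m + 1) ⊕ Fin m) → ℕ × ℕ :=
    Sum.elim (fun i => (i + 1, m - i)) (Sum.elim (fun k => (k, m - k)) fun k => (k + 2, m - k))
  rw [fSigma1, numSYT_eq _ _ pos, volume_sum_setOf_coord_lt]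
  · rw [← lintegral_chain _ measurable_stripKernel _ (by fun_prop) m _ (by fun_prop)]
    congr 1
    · congr 2
      simp
      omega
    · refine lintegral_congr fun b => ?_
      rw [Fintype.prod_sum_type, Fin.prod_univ_succ, mul_assoc, ← Finset.prod_mul_distrib, mul_one]
      congr 1
      · rw [← volume_setOf_forall_lt_single b 0 (fun i => Adjacent (pos (.inr (.inl 0))) (pos (.inl i)))]
        · congr 1
          ext y
          simp only [Set.mem_ofPred_eq, and_iff_left_iff_imp]
          intro _ i h
          simp [pos, Adjacent] at h
        · intro i
          simp only [pos, Adjacent, Sum.elim_inl, Sum.elim_inr, Fin.ext_iff, Fin.val_zero]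
          omega
      · refine Finset.prod_congr rfl fun j _ => ?_
        have hj := j.2
        · rw [stripKernel]
          congr 1
          · rw [← volume_setOf_forall_lt_pair b j
              (fun i => Adjacent (pos (.inr (.inl j.succ))) (pos (.inl i)))]
            · congr 1
              ext y
              simp only [Set.mem_ofPred_eq, and_iff_left_iff_imp]
              intro _ i h
              simp [pos, Adjacent] at h
              omega
            · intro i
              simp [pos, Adjacent, Fin.ext_iff]
              omega
          · rw [← volume_setOf_forall_gt_pair b j
              (fun i => Adjacent (pos (.inl i)) (pos (.inr (.inr j))))]
            · congr 1
              ext y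
              simp only [Set.mem_ofPred_eq, and_iff_right_iff_imp]
              intro _ i h
              simp [pos, Adjacent] at h
              omega
            · intro i
              simp [pos, Adjacent, Fin.ext_iff]
              omega
  · intro i j
    simp [pos, Adjacent]
    omega
  · rintro (i | i) (j | j) <;> simp [pos, Adjacent] <;> omega
  · rintro (i | i | i) (j | j | j) <;> simp [pos, Fin.ext_iff] <;> omega
  · rintro ⟨i, j⟩
    rw [mem_skewCells, mem_outerShape, mem_innerShape]
    simp only [Sum.exists, pos, Sum.elim_inl, Sum.elim_inr, Prod.mk.injEq]
    constructor
    · intro h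
      rcases (by omega : i + j = m ∨ i + j = m + 1 ∨ i + j = m + 2) with h1 | h1 | h1
      · exact Or.inr (Or.inl ⟨⟨i, by omega⟩, rfl, by simp; omega⟩)
      · exact Or.inl ⟨⟨i - 1, by omega⟩, by simp; omega, by simp; omega⟩
      · exact Or.inr (Or.inr ⟨⟨i - 2, by omega⟩, by simp; omega, by simp; omega⟩)
    · rintro (⟨a, rfl, rfl⟩ | ⟨a, rfl, rfl⟩ | ⟨a, rfl, rfl⟩) <;> omega

theorem fSigma0_eq (m : ℕ) : (fSigma0 (m + 1) : ENNReal) =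
    (3 * m + 3).factorial *
      ∫⁻ y, (transfer stripKernel)^[m] (fun x => ENNReal.ofReal x) y *
        ENNReal.ofReal (1 - y) := by
  -- Compared with $\sigma_{3n-1}$ there is one more lower box $(m+2,0)$, lying only below the last
  -- middle box; it supplies the final weight $1-y$.
  let pos : Fin (m + 1) ⊕ (Fin (m + 1) ⊕ Fin (m + 1)) → ℕ × ℕ :=
    Sum.elim (fun i => (i + 1, m - i)) (Sum.elim (fun k => (k, m - k)) fun k => (k + 2, m - k))
  rw [fSigma0, numSYT_eq _ _ pos, volume_sum_setOf_coord_lt]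
  · rw [← lintegral_chain _ measurable_stripKernel _ (by fun_prop) m _ (by fun_prop)]
    congr 1
    · congr 2
      simp
      omega
    · refine lintegral_congr fun b => ?_
      -- Split off the first upper box and the last lower box; upper box `j + 1` then pairs with
      -- lower box `j`.
      rw [Fintype.prod_sum_type, Fin.prod_univ_succ, Fin.prod_univ_castSucc, mul_assoc,
        ← mul_assoc (Finset.prod _ _), ← Finset.prod_mul_distrib, mul_assoc]
      congr 1
      · rw [← volume_setOf_forall_lt_single b 0 (fun i => Adjacent (pos (.inr (.inl 0))) (pos (.inl i)))]
        · congr 1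
          ext y
          simp only [Set.mem_ofPred_eq, and_iff_left_iff_imp]
          intro _ i h
          simp [pos, Adjacent] at h
        · intro i
          simp only [pos, Adjacent, Sum.elim_inl, Sum.elim_inr, Fin.ext_iff, Fin.val_zero]
          omega
      congr 1
      · refine Finset.prod_congr rfl fun j _ => ?_
        have hj := j.2
        · rw [stripKernel]
          congr 1
          · rw [← volume_setOf_forall_lt_pair b j
              (fun i => Adjacent (pos (.inr (.inl j.succ))) (pos (.inl i)))]
            · congr 1
              ext y
              simp only [Set.mem_ofPred_eq, and_iff_left_iff_imp]
              intro _ i h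
              simp [pos, Adjacent] at h
              omega
            · intro i
              simp [pos, Adjacent, Fin.ext_iff]
              omega
          · rw [← volume_setOf_forall_gt_pair b j
              (fun i => Adjacent (pos (.inl i)) (pos (.inr (.inr j.castSucc))))]
            · congr 1
              ext y
              simp only [Set.mem_ofPred_eq, and_iff_right_iff_imp]
              intro _ i h
              simp [pos, Adjacent] at h
              omega
            · intro i
              simp [pos, Adjacent, Fin.ext_iff]
              omega
      · rw [← volume_setOf_forall_gt_single b (Fin.last m)
          (fun i => Adjacent (pos (.inl i)) (pos (.inr (.inr (Fin.last m)))))]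
        · congr 1
          ext y
          simp only [Set.mem_ofPred_eq, and_iff_right_iff_imp]
          intro _ i h
          simp [pos, Adjacent] at h
          omega
        · intro i
          simp [pos, Adjacent, Fin.ext_iff]
          omega
  · intro i j
    simp [pos, Adjacent]
    omega
  · rintro (i | i) (j | j) <;> simp [pos, Adjacent] <;> omega
  · rintro (i | i | i) (j | j | j) <;> simp [pos, Fin.ext_iff] <;> omega
  · rintro ⟨i, j⟩
    rw [mem_skewCells, mem_outerShape, mem_innerShape]
    simp only [Sum.exists, pos, Sum.elim_inl, Sum.elim_inr, Prod.mk.injEq]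
    constructor
    · intro h
      rcases (by omega : i + j = m ∨ i + j = m + 1 ∨ i + j = m + 2) with h1 | h1 | h1
      · exact Or.inr (Or.inl ⟨⟨i, by omega⟩, rfl, by simp; omega⟩)
      · exact Or.inl ⟨⟨i - 1, by omega⟩, by simp; omega, by simp; omega⟩
      · exact Or.inr (Or.inr ⟨⟨i - 2, by omega⟩, by simp; omega, by simp; omega⟩)
    · rintro (⟨a, rfl, rfl⟩ | ⟨a, rfl, rfl⟩ | ⟨a, rfl, rfl⟩) <;> omega

theorem eulerNumber_eq (m : ℕ) : (eulerNumber (2 * m + 1) : ENNReal) =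
    (2 * m + 1).factorial * ∫⁻ y, (transfer peakKernel)^[m] (fun _ => 1) y * 1 := by
  -- Counted from `0`, the valleys are the even positions and the peaks the odd ones. The peaks are
  -- integrated out, each between two consecutive valleys.
  let pos : Fin (m + 1) ⊕ Fin m → ℕ := Sum.elim (fun i => 2 * i) fun k => 2 * k + 1
  have hpos : ∀ a, pos a < 2 * m + 1 := by
    rintro (i | i) <;> simp [pos] <;> omega
  let e : Fin (m + 1) ⊕ Fin m ≃ Fin (2 * m + 1) := Equiv.ofBijective (fun a => ⟨pos a, hpos a⟩)
    ⟨fun a b h => by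
      revert a b
      rintro (i | i) (j | j) <;> simp [pos, Fin.ext_iff] <;> omega, fun p => by
      rcases Nat.even_or_odd' p.1 with ⟨k, hk | hk⟩
      · exact ⟨.inl ⟨k, by omega⟩, Fin.ext hk.symm⟩
      · exact ⟨.inr ⟨k, by omega⟩, Fin.ext hk.symm⟩⟩
  have he : ∀ a, (e a : ℕ) = pos a := fun a => rfl
  let r : ℕ → ℕ → Prop := fun i j => (Even i ∧ j = i + 1) ∨ (Odd j ∧ i = j + 1)
  have hcount : eulerNumber (2 * m + 1) = Nat.card {T : Fin (m + 1) ⊕ Fin m ≃ Fin (2 * m + 1) //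
      ∀ a b, r (pos a) (pos b) → T a < T b} := by
    refine Nat.card_congr (Equiv.subtypeEquiv (e.equivCongr (Equiv.refl _)).symm fun T => ?_)
    have h1 : IsUpDown T ↔ ∀ i j : Fin (2 * m + 1), r i j → T i < T j := by
      constructor
      · rintro h ⟨i, hi⟩ ⟨j, hj⟩ (⟨h1, h2⟩ | ⟨h1, h2⟩)
        · obtain rfl : j = i + 1 := h2
          exact (h i hj).1 h1
        · obtain rfl : i = j + 1 := h2
          exact (h j hi).2 h1
      · exact fun h i hi => ⟨fun h1 => h _ _ (Or.inl ⟨h1, rfl⟩), fun h1 => h _ _ (Or.inr ⟨h1, rfl⟩)⟩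
    rw [h1]
    refine (e.forall_congr fun a => e.forall_congr fun b => ?_).symm
    simp [he]
  have hr : ∀ i j, r i j → (Even i ∧ Odd j) := by
    rintro i j (⟨h, rfl⟩ | ⟨h, rfl⟩)
    · exact ⟨h, h.add_one⟩
    · exact ⟨h.add_one, h⟩
  rw [hcount, card_linearExtensions (Fintype.card_congr e), volume_sum_setOf_coord_lt,
    ← lintegral_chain _ measurable_peakKernel _ (by fun_prop) m _ (by fun_prop)]
  · congr 1
    · congr 2
      simp
      omega
    · refine lintegral_congr fun b => ?_
      rw [one_mul, mul_one]
      refine Finset.prod_congr rfl fun j _ => ?_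
      have hj := j.2
      rw [peakKernel, ← volume_setOf_forall_gt_pair b j (fun i => r (pos (.inl i)) (pos (.inr j)))]
      · congr 1
        ext y
        simp only [Set.mem_ofPred_eq, and_iff_right_iff_imp]
        intro _ i h
        have := (hr _ _ h).1
        simp [pos, parity_simps] at this
      · intro i
        simp [pos, r, Fin.ext_iff, parity_simps]
        omega
  · intro i j h
    have := Nat.odd_iff.1 (hr _ _ h).2
    simp only [pos, Sum.elim_inl] at this
    omega
  · intro i j h
    have := (hr _ _ h).1
    simp [pos, parity_simps] at this

/-! ### From extended nonnegative integrals to real ones -/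

section RealIntegrals

open intervalIntegral

theorem lintegral_unitInterval_ofReal {f : ℝ → ℝ} (hf : Continuous f)
    (hf0 : ∀ x : I, 0 ≤ f x) :
    ∫⁻ x : I, ENNReal.ofReal (f x) = ENNReal.ofReal (∫ x in (0 : ℝ)..1, f x) := by
  have h1 := unitInterval.measurePreserving_coe.lintegral_comp_emb
    unitInterval.measurableEmbedding_coe fun x => ENNReal.ofReal (f x)
  rw [h1, integral_of_le zero_le_one, ← integral_Icc_eq_integral_Ioc,
    ofReal_integral_eq_lintegral_ofReal]
  · exact hf.continuousOn.integrableOn_Icc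
  · rw [Filter.EventuallyLE, ae_restrict_iff' measurableSet_Icc]
    exact Filter.Eventually.of_forall fun x hx => hf0 ⟨x, hx⟩

/-- Nonnegativity of `q m` is carried through the induction because `ENNReal.ofReal` truncates
negative values and is multiplicative only without them. -/
theorem iterate_transfer_ofReal {k : ℝ → ℝ → ℝ} (hk : ∀ y, Continuous fun x => k x y)
    (hk0 : ∀ x y : I, 0 ≤ k x y) {q : ℕ → ℝ → ℝ} (hq : ∀ m, Continuous (q m))
    (hq0 : ∀ x : I, 0 ≤ q 0 x)
    (hrec : ∀ m, ∀ y : I, ∫ x in (0 : ℝ)..1, q m x * k x y = q (m + 1) y) (m : ℕ) :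
    (transfer fun x y : I => ENNReal.ofReal (k x y))^[m] (fun x => ENNReal.ofReal (q 0 x)) =
      (fun x : I => ENNReal.ofReal (q m x)) ∧ ∀ x : I, 0 ≤ q m x := by
  induction m with
  | zero => exact ⟨rfl, hq0⟩
  | succ m ih =>
    have hnn : ∀ y x : I, 0 ≤ q m x * k x y := fun y x => mul_nonneg (ih.2 x) (hk0 x y)
    constructor
    · rw [Function.iterate_succ_apply', ih.1]
      ext y
      rw [transfer, ← hrec, ← lintegral_unitInterval_ofReal (f := fun x => q m x * k x y)
        ((hq m).mul (hk y)) (hnn y)]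
      exact lintegral_congr fun x => (ENNReal.ofReal_mul (ih.2 x)).symm
    · intro y
      rw [← hrec]
      exact integral_nonneg zero_le_one fun x hx => hnn y ⟨x, hx⟩

theorem lintegral_iterate_transfer {k : ℝ → ℝ → ℝ} (hk : ∀ y, Continuous fun x => k x y)
    (hk0 : ∀ x y : I, 0 ≤ k x y) {q : ℕ → ℝ → ℝ} (hq : ∀ m, Continuous (q m))
    (hq0 : ∀ x : I, 0 ≤ q 0 x)
    (hrec : ∀ m, ∀ y : I, ∫ x in (0 : ℝ)..1, q m x * k x y = q (m + 1) y)
    {h : ℝ → ℝ} (hh : Continuous h) (hh0 : ∀ x : I, 0 ≤ h x) (m : ℕ) :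
    (∫⁻ y : I, (transfer fun x y : I => ENNReal.ofReal (k x y))^[m]
      (fun x => ENNReal.ofReal (q 0 x)) y * ENNReal.ofReal (h y)).toReal =
      ∫ y in (0 : ℝ)..1, q m y * h y := by
  obtain ⟨h1, h2⟩ := iterate_transfer_ofReal hk hk0 hq hq0 hrec m
  have hnn : ∀ x : I, 0 ≤ q m x * h x := fun x => mul_nonneg (h2 x) (hh0 x)
  rw [h1, ← ENNReal.toReal_ofReal (r := ∫ y in (0 : ℝ)..1, q m y * h y)
    (integral_nonneg zero_le_one fun x hx => hnn ⟨x, hx⟩),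
    ← lintegral_unitInterval_ofReal (f := fun x => q m x * h x) ((hq m).mul hh) hnn]
  congr 1
  exact lintegral_congr fun x => (ENNReal.ofReal_mul (h2 x)).symm

/-- The right side is the solution of $-u''=y^n$ with $u(0)=u(1)=0$; the integral is evaluated
directly by splitting at `y`. -/
theorem integral_pow_mul_stripKernel (n : ℕ) (y : I) :
    ∫ x in (0 : ℝ)..1, x ^ n * (min x y * (1 - max x y)) =
      ((y : ℝ) - (y : ℝ) ^ (n + 2)) / ((n + 1) * (n + 2)) := by
  obtain ⟨y, hy0, hy1⟩ := y
  have hint : ∀ a b : ℝ, IntervalIntegrable (fun x => x ^ n * (min x y * (1 - max x y)))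
      volume a b := fun a b => Continuous.intervalIntegrable (by fun_prop) a b
  rw [← integral_add_adjacent_intervals (hint 0 y) (hint y 1)]
  have h1 : ∫ x in (0 : ℝ)..y, x ^ n * (min x y * (1 - max x y)) =
      ∫ x in (0 : ℝ)..y, (1 - y) * x ^ (n + 1) := by
    refine integral_congr fun x hx => ?_
    rw [Set.uIcc_of_le hy0] at hx
    simp only [min_eq_left hx.2, max_eq_right hx.2]
    ring
  have h2 : ∫ x in y..1, x ^ n * (min x y * (1 - max x y)) =
      ∫ x in y..1, y * (x ^ n - x ^ (n + 1)) := by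
    refine integral_congr fun x hx => ?_
    rw [Set.uIcc_of_le hy1] at hx
    simp only [min_eq_right hx.1, max_eq_left hx.1]
    ring
  rw [h1, h2, intervalIntegral.integral_const_mul, intervalIntegral.integral_const_mul,
    intervalIntegral.integral_sub
    (Continuous.intervalIntegrable (by fun_prop) _ _)
    (Continuous.intervalIntegrable (by fun_prop) _ _)]
  simp only [integral_pow]
  push_cast
  have : (n : ℝ) + 1 + 1 ≠ 0 := by positivity
  field_simp
  ring

/-- Here the boundary conditions of $-u''=y^n$ are $u'(0)=0$ and $u(1)=0$. -/
theorem integral_pow_mul_peakKernel (n : ℕ) (y : I) :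
    ∫ x in (0 : ℝ)..1, x ^ n * (1 - max x y) =
      (1 - (y : ℝ) ^ (n + 2)) / ((n + 1) * (n + 2)) := by
  obtain ⟨y, hy0, hy1⟩ := y
  have hint : ∀ a b : ℝ, IntervalIntegrable (fun x => x ^ n * (1 - max x y))
      volume a b := fun a b => Continuous.intervalIntegrable (by fun_prop) a b
  rw [← integral_add_adjacent_intervals (hint 0 y) (hint y 1)]
  have h1 : ∫ x in (0 : ℝ)..y, x ^ n * (1 - max x y) =
      ∫ x in (0 : ℝ)..y, (1 - y) * x ^ n := by
    refine integral_congr fun x hx => ?_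
    rw [Set.uIcc_of_le hy0] at hx
    simp only [max_eq_right hx.2]
    ring
  have h2 : ∫ x in y..1, x ^ n * (1 - max x y) = ∫ x in y..1, (x ^ n - x ^ (n + 1)) := by
    refine integral_congr fun x hx => ?_
    rw [Set.uIcc_of_le hy1] at hx
    simp only [max_eq_left hx.1]
    ring
  rw [h1, h2, intervalIntegral.integral_const_mul, intervalIntegral.integral_sub
    (Continuous.intervalIntegrable (by fun_prop) _ _)
    (Continuous.intervalIntegrable (by fun_prop) _ _)]
  simp only [integral_pow]
  push_cast
  have : (n : ℝ) + 1 + 1 ≠ 0 := by positivity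
  field_simp
  ring

end RealIntegrals

/-! ### Generating functions of the iterates -/

section Eigenfunction

open intervalIntegral Finset PowerSeries

/-- The power series `∑ (-1) ^ j z ^ j / (2 j + a)!`. -/
noncomputable def trigTail (a : ℕ) : PowerSeries ℚ :=
  PowerSeries.mk fun j => (-1) ^ j / ((2 * j + a).factorial : ℚ)

theorem constantCoeff_trigTail (a : ℕ) : constantCoeff (trigTail a) = (a.factorial : ℚ)⁻¹ := by
  rw [← coeff_zero_eq_constantCoeff_apply, trigTail, coeff_mk]
  simp

theorem coeff_mul_trigTail (S : PowerSeries ℚ) (a m : ℕ) :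
    coeff m (S * trigTail a) = ∑ j ∈ range (m + 1),
      coeff (m - j) S * ((-1) ^ j / ((2 * j + a).factorial : ℚ)) := by
  rw [mul_comm, coeff_mul, Finset.Nat.sum_antidiagonal_eq_sum_range_succ_mk]
  exact sum_congr rfl fun j _ => by rw [trigTail, coeff_mk, mul_comm]

/-- The coefficient of `t ^ (2 m)` in `S (t ^ 2) * ∑ (-1) ^ j t ^ (2 j) x ^ (2 j + a) / (2 j + a)!`,
as a function of `x`. -/
noncomputable def trigCoeff (S : PowerSeries ℚ) (a m : ℕ) (x : ℝ) : ℝ :=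
  ∑ j ∈ range (m + 1),
    ((coeff (m - j) S * ((-1) ^ j / ((2 * j + a).factorial : ℚ)) : ℚ) : ℝ) * x ^ (2 * j + a)

theorem continuous_trigCoeff (S : PowerSeries ℚ) (a m : ℕ) : Continuous (trigCoeff S a m) := by
  unfold trigCoeff
  fun_prop

theorem trigCoeff_zero_left (S : PowerSeries ℚ) (a : ℕ) (h : S * trigTail a = 1) (x : ℝ) :
    trigCoeff S a 0 x = x ^ a := by
  have h0 : coeff 0 (S * trigTail a) = 1 := by simp [h]
  rw [coeff_mul_trigTail] at h0
  simp only [zero_add, range_one, sum_singleton] at h0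
  simp only [trigCoeff, zero_add, range_one, sum_singleton, h0]
  simp

/-- The operator sends $x^{2j+a}/(2j+a)!$ to $(y^a-y^{2j+2+a})/(2j+2+a)!$. The second terms are
those of index $j+1$ in the next function; the multiples of $y^a$ add up to its term of index $0$,
since coefficient $m+1$ of `S * trigTail a` vanishes. The exponent `a` is $1$ for `stripKernel` and
$0$ for `peakKernel`. -/
theorem integral_trigCoeff_mul_kernel {S : PowerSeries ℚ} {a : ℕ} (h : S * trigTail a = 1)
    {k : ℝ → ℝ} (hk : Continuous k) {y : ℝ}
    (hint : ∀ n : ℕ, ∫ x in (0 : ℝ)..1, x ^ n * k x =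
      (y ^ a - y ^ (n + 2)) / ((n + 1) * (n + 2))) (m : ℕ) :
    ∫ x in (0 : ℝ)..1, trigCoeff S a m x * k x = trigCoeff S a (m + 1) y := by
  have h1 : coeff (m + 1) (S * trigTail a) = 0 := by rw [h, coeff_one, if_neg (by omega)]
  rw [coeff_mul_trigTail, sum_range_succ'] at h1
  have h1' := congrArg (fun q : ℚ => (q : ℝ)) h1
  simp only [Rat.cast_add, Rat.cast_sum, Rat.cast_zero] at h1'
  simp only [trigCoeff, sum_mul]
  rw [integral_finsetSum fun j _ => Continuous.intervalIntegrable (by fun_prop) _ _,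
    sum_range_succ' _ (m + 1), ← sub_eq_zero]
  have h2 : ((coeff (m + 1 - 0) S * ((-1) ^ 0 / ((2 * 0 + a).factorial : ℚ)) : ℚ) : ℝ) *
      y ^ (2 * 0 + a) = - ∑ j ∈ range (m + 1),
      ((coeff (m + 1 - (j + 1)) S *
        ((-1) ^ (j + 1) / ((2 * (j + 1) + a).factorial : ℚ)) : ℚ) : ℝ) * y ^ a := by
    rw [← sum_mul, eq_neg_of_add_eq_zero_right h1']
    simp
  rw [h2, ← sub_sub, sub_neg_eq_add, ← sum_sub_distrib, ← sum_add_distrib]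
  refine sum_eq_zero fun j _ => ?_
  simp_rw [mul_assoc]
  rw [intervalIntegral.integral_const_mul, hint, Nat.add_sub_add_right,
    show 2 * (j + 1) + a = (2 * j + a) + 1 + 1 by ring, Nat.factorial_succ, Nat.factorial_succ]
  push_cast
  have := Nat.factorial_ne_zero (2 * j + a)
  field_simp
  ring

end Eigenfunction

/-! ### The counts as coefficients of quotients of trigonometric series -/

section Values

open Finset PowerSeries

theorem integral_trigCoeff (S : PowerSeries ℚ) (a m : ℕ) :
    ∫ x in (0 : ℝ)..1, trigCoeff S a m x = ((coeff m (S * trigTail (a + 1)) : ℚ) : ℝ) := by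
  simp only [trigCoeff]
  rw [coeff_mul_trigTail,
    intervalIntegral.integral_finsetSum fun j _ => Continuous.intervalIntegrable (by fun_prop) _ _,
    Rat.cast_sum]
  refine sum_congr rfl fun j _ => ?_
  rw [intervalIntegral.integral_const_mul, integral_pow, ← add_assoc, Nat.factorial_succ]
  push_cast
  have := Nat.factorial_ne_zero (2 * j + a)
  field_simp
  simp

theorem integral_trigCoeff_mul_one_sub (S : PowerSeries ℚ) (a m : ℕ) :
    ∫ x in (0 : ℝ)..1, trigCoeff S a m x * (1 - x) =
      ((coeff m (S * trigTail (a + 2)) : ℚ) : ℝ) := by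
  simp only [trigCoeff, sum_mul]
  rw [coeff_mul_trigTail,
    intervalIntegral.integral_finsetSum fun j _ => Continuous.intervalIntegrable (by fun_prop) _ _,
    Rat.cast_sum]
  refine sum_congr rfl fun j _ => ?_
  have h : ∀ x : ℝ, x ^ (2 * j + a) * (1 - x) = x ^ (2 * j + a) - x ^ (2 * j + a + 1) :=
    fun x => by ring
  simp_rw [mul_assoc, h]
  rw [intervalIntegral.integral_const_mul, intervalIntegral.integral_sub
    (Continuous.intervalIntegrable (by fun_prop) _ _)
    (Continuous.intervalIntegrable (by fun_prop) _ _)]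
  simp only [integral_pow]
  rw [show 2 * j + (a + 2) = 2 * j + a + 1 + 1 by ring, Nat.factorial_succ, Nat.factorial_succ]
  push_cast
  have := Nat.factorial_ne_zero (2 * j + a)
  field_simp
  simp

theorem trigTail_inv_mul (a : ℕ) : (trigTail a)⁻¹ * trigTail a = 1 := by
  refine PowerSeries.inv_mul_cancel _ ?_
  rw [constantCoeff_trigTail]
  have := Nat.factorial_ne_zero a
  positivity

theorem eq_factorial_mul_of_ennreal {N F : ℕ} {x : ENNReal} {q : ℚ}
    (h : (N : ENNReal) = F.factorial * x) (hx : x.toReal = q) : (N : ℚ) = F.factorial * q := by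
  have := congrArg ENNReal.toReal h
  rw [ENNReal.toReal_mul, hx] at this
  simp only [ENNReal.toReal_natCast] at this
  exact_mod_cast this

/-- The real form of `stripKernel`. -/
noncomputable def stripKernelReal (x y : ℝ) : ℝ := min x y * (1 - max x y)

theorem continuous_stripKernelReal (y : ℝ) : Continuous fun x => stripKernelReal x y := by
  unfold stripKernelReal
  fun_prop

theorem stripKernelReal_nonneg (x y : I) : 0 ≤ stripKernelReal x y :=
  mul_nonneg (le_min x.2.1 y.2.1) (sub_nonneg.2 (max_le x.2.2 y.2.2))

theorem stripKernel_eq : stripKernel = fun x y : I => ENNReal.ofReal (stripKernelReal x y) := by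
  ext x y
  rw [stripKernelReal, ENNReal.ofReal_mul (le_min x.2.1 y.2.1), stripKernel]
  rfl

theorem integral_trigCoeff_stripKernel (m : ℕ) (y : I) :
    ∫ x in (0 : ℝ)..1, trigCoeff (trigTail 1)⁻¹ 1 m x * stripKernelReal x y =
      trigCoeff (trigTail 1)⁻¹ 1 (m + 1) y :=
  integral_trigCoeff_mul_kernel (trigTail_inv_mul 1) (continuous_stripKernelReal y)
    (fun n => by rw [pow_one]; exact integral_pow_mul_stripKernel n y) m

theorem fSigma1_eq_coeff (m : ℕ) : (fSigma1 (m + 1) : ℚ) =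
    (3 * m + 2).factorial * coeff m ((trigTail 1)⁻¹ * trigTail 2) := by
  refine eq_factorial_mul_of_ennreal (fSigma1_eq m) ?_
  have h := lintegral_iterate_transfer (q := trigCoeff (trigTail 1)⁻¹ 1) (h := fun _ => 1)
    continuous_stripKernelReal stripKernelReal_nonneg (fun m => continuous_trigCoeff _ _ m)
    (fun x => by rw [trigCoeff_zero_left _ _ (trigTail_inv_mul 1), pow_one]; exact x.2.1)
    integral_trigCoeff_stripKernel continuous_const (fun _ => zero_le_one) m
  simp only [trigCoeff_zero_left _ _ (trigTail_inv_mul 1), pow_one, mul_one,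
    integral_trigCoeff, ENNReal.ofReal_one] at h
  rw [stripKernel_eq, ← h]
  simp only [mul_one]

theorem fSigma0_eq_coeff (m : ℕ) : (fSigma0 (m + 1) : ℚ) =
    (3 * m + 3).factorial * coeff m ((trigTail 1)⁻¹ * trigTail 3) := by
  refine eq_factorial_mul_of_ennreal (fSigma0_eq m) ?_
  have h := lintegral_iterate_transfer (q := trigCoeff (trigTail 1)⁻¹ 1) (h := fun x => 1 - x)
    continuous_stripKernelReal stripKernelReal_nonneg (fun m => continuous_trigCoeff _ _ m)
    (fun x => by rw [trigCoeff_zero_left _ _ (trigTail_inv_mul 1), pow_one]; exact x.2.1)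
    integral_trigCoeff_stripKernel (by fun_prop) (fun x => sub_nonneg.2 x.2.2) m
  simp only [trigCoeff_zero_left _ _ (trigTail_inv_mul 1), pow_one,
    integral_trigCoeff_mul_one_sub] at h
  rw [stripKernel_eq, ← h]

/-- The initial function is $1=x+(1-x)$, and the kernel is invariant under $(x,y)\mapsto(1-x,1-y)$.
So the iterates are $p_m(x)+p_m(1-x)$, with $p_m$ the iterates of $x$, and both summands have the
same integral. -/
theorem fSigma2_eq_coeff (m : ℕ) : (fSigma2 (m + 1) : ℚ) =
    (3 * m + 1).factorial * (2 * coeff m ((trigTail 1)⁻¹ * trigTail 2)) := by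
  refine eq_factorial_mul_of_ennreal (fSigma2_eq m) ?_
  let p := trigCoeff (trigTail 1)⁻¹ 1
  have hp : ∀ m, Continuous (p m) := fun m => continuous_trigCoeff _ _ m
  have hp0 : ∀ x, p 0 x = x := fun x => by
    simp only [p]
    rw [trigCoeff_zero_left _ _ (trigTail_inv_mul 1), pow_one]
  have h := lintegral_iterate_transfer (q := fun m x => p m x + p m (1 - x)) (h := fun _ => 1)
    continuous_stripKernelReal stripKernelReal_nonneg
    (fun m => (hp m).add ((hp m).comp (by fun_prop)))
    (fun x => by simp [hp0]) (fun m y => ?_) continuous_const (fun _ => zero_le_one) m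
  · have hsum : ∫ y in (0 : ℝ)..1, (p m y + p m (1 - y)) =
        ((2 * coeff m ((trigTail 1)⁻¹ * trigTail 2) : ℚ) : ℝ) := by
      have hc : Continuous fun x => p m (1 - x) := (hp m).comp (by fun_prop)
      rw [intervalIntegral.integral_add ((hp m).intervalIntegrable _ _)
        (hc.intervalIntegrable _ _),
        intervalIntegral.integral_comp_sub_left (p m), sub_self, sub_zero, integral_trigCoeff]
      push_cast
      ring
    simp only [hp0, add_sub_cancel, mul_one, hsum, ENNReal.ofReal_one] at h
    rw [stripKernel_eq, ← h]
    simp only [mul_one]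
  · have hc : Continuous fun x => p m (1 - x) * stripKernelReal x y :=
      ((hp m).comp (by fun_prop)).mul (continuous_stripKernelReal y)
    have hsymm : ∀ x, stripKernelReal x y = stripKernelReal (1 - x) (σ y : I) := fun x => by
      simp only [stripKernelReal, unitInterval.coe_symm_eq]
      rw [min_sub_sub_left, max_sub_sub_left]
      ring
    have hrefl : ∫ x in (0 : ℝ)..1, p m (1 - x) * stripKernelReal x y = p (m + 1) (1 - y) := by
      simp_rw [hsymm]
      rw [intervalIntegral.integral_comp_sub_left (fun x => p m x * stripKernelReal x (σ y : I)),
        sub_self, sub_zero, integral_trigCoeff_stripKernel]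
      rfl
    have hc' : Continuous fun x => p m x * stripKernelReal x y :=
      (hp m).mul (continuous_stripKernelReal y)
    simp only [add_mul]
    rw [intervalIntegral.integral_add (hc'.intervalIntegrable _ _)
      (hc.intervalIntegrable _ _), hrefl, integral_trigCoeff_stripKernel]

theorem eulerNumber_eq_coeff (m : ℕ) : (eulerNumber (2 * m + 1) : ℚ) =
    (2 * m + 1).factorial * coeff m ((trigTail 0)⁻¹ * trigTail 1) := by
  refine eq_factorial_mul_of_ennreal (eulerNumber_eq m) ?_
  have h := lintegral_iterate_transfer (q := trigCoeff (trigTail 0)⁻¹ 0) (h := fun _ => 1)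
    (k := fun x y => 1 - max x y) (fun y => by fun_prop)
    (fun x y => sub_nonneg.2 (max_le x.2.2 y.2.2)) (fun m => continuous_trigCoeff _ _ m)
    (fun x => by rw [trigCoeff_zero_left _ _ (trigTail_inv_mul 0), pow_zero]; exact zero_le_one)
    (fun m y => integral_trigCoeff_mul_kernel (trigTail_inv_mul 0) (by fun_prop)
      (fun n => by rw [pow_zero]; exact integral_pow_mul_peakKernel n y) m)
    continuous_const (fun _ => zero_le_one) m
  simp only [trigCoeff_zero_left _ _ (trigTail_inv_mul 0), pow_zero, mul_one,
    integral_trigCoeff, ENNReal.ofReal_one] at h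
  rw [← h]
  simp only [mul_one]
  rfl

end Values

/-! ### Formal trigonometric identities -/

section Trigonometry

open PowerSeries

theorem derivative_sin : d⁄dX ℚ (sin ℚ) = cos ℚ := by
  ext n
  rw [coeff_derivative, sin, cos, coeff_mk, coeff_mk]
  by_cases h : Even n
  · obtain ⟨k, rfl⟩ := h
    have h2 : ¬ Even (k + k + 1) := by simp [parity_simps]
    rw [if_neg h2, if_pos ⟨k, rfl⟩, show (k + k + 1) / 2 = (k + k) / 2 by omega, Nat.factorial_succ]
    have := Nat.factorial_ne_zero (k + k)
    simp only [Algebra.algebraMap_self, RingHom.id_apply]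
    push_cast
    field_simp
  · have h2 : Even (n + 1) := by simpa [parity_simps] using h
    rw [if_pos h2, if_neg h, zero_mul]

theorem derivative_cos : d⁄dX ℚ (cos ℚ) = -sin ℚ := by
  ext n
  rw [coeff_derivative, map_neg, sin, cos, coeff_mk, coeff_mk]
  by_cases h : Even n
  · have h2 : ¬ Even (n + 1) := by simpa [parity_simps] using h
    rw [if_pos h, if_neg h2, zero_mul, neg_zero]
  · obtain ⟨k, rfl⟩ := Nat.not_even_iff_odd.1 h
    have h2 : Even (2 * k + 1 + 1) := by simp [parity_simps]
    rw [if_neg h, if_pos h2, show (2 * k + 1 + 1) / 2 = (2 * k + 1) / 2 + 1 by omega,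
      Nat.factorial_succ]
    have := Nat.factorial_ne_zero (2 * k + 1)
    simp only [Algebra.algebraMap_self, RingHom.id_apply]
    push_cast
    field_simp
    ring

theorem derivative_rescale (a : ℚ) (f : PowerSeries ℚ) :
    d⁄dX ℚ (rescale a f) = C a * rescale a (d⁄dX ℚ f) := by
  ext n
  simp only [coeff_derivative, coeff_rescale, coeff_C_mul]
  ring

theorem constantCoeff_sin : constantCoeff (sin ℚ) = 0 := by
  rw [← coeff_zero_eq_constantCoeff_apply, sin, coeff_mk]
  simp

theorem constantCoeff_cos : constantCoeff (cos ℚ) = 1 := by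
  rw [← coeff_zero_eq_constantCoeff_apply, cos, coeff_mk]
  simp

theorem constantCoeff_rescale (a : ℚ) (f : PowerSeries ℚ) :
    constantCoeff (rescale a f) = constantCoeff f := by
  rw [← coeff_zero_eq_constantCoeff_apply, coeff_rescale]
  simp

theorem sin_sq_add_cos_sq : sin ℚ ^ 2 + cos ℚ ^ 2 = 1 := by
  apply derivative.ext
  · simp only [map_add, pow_two, Derivation.leibniz, derivative_sin, derivative_cos, smul_eq_mul,
      derivative_one]
    ring
  · simp [constantCoeff_sin, constantCoeff_cos]

/-- With $s=\sin x$ and $c=\cos x$, `h1` and `h2` express $\sin(2x-2x)=0$ and $\cos(2x-2x)=1$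
through $2sc$ and $c^2-s^2$; each follows by comparing derivatives and constant terms. They form a
linear system for the two unknown series, with determinant $(2sc)^2+(c^2-s^2)^2=1$ up to sign. -/
theorem rescale_two_sin_cos : rescale 2 (sin ℚ) = 2 * sin ℚ * cos ℚ ∧
    rescale 2 (cos ℚ) = cos ℚ ^ 2 - sin ℚ ^ 2 := by
  have hC : (C (2 : ℚ) : PowerSeries ℚ) = 2 := map_ofNat C 2
  have hd2 : d⁄dX ℚ (2 : PowerSeries ℚ) = 0 := by rw [← hC, derivative_C]
  have h1 : rescale 2 (sin ℚ) * (cos ℚ ^ 2 - sin ℚ ^ 2) =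
      rescale 2 (cos ℚ) * (2 * sin ℚ * cos ℚ) := by
    apply derivative.ext
    · simp only [map_sub, pow_two, Derivation.leibniz, derivative_sin, derivative_cos,
        smul_eq_mul, derivative_rescale, map_neg, hC, hd2]
      ring
    · simp [constantCoeff_sin, constantCoeff_rescale]
  have h2 : rescale 2 (sin ℚ) * (2 * sin ℚ * cos ℚ) +
      rescale 2 (cos ℚ) * (cos ℚ ^ 2 - sin ℚ ^ 2) = 1 := by
    apply derivative.ext
    · simp only [map_sub, map_add, pow_two, Derivation.leibniz, derivative_sin, derivative_cos,
        smul_eq_mul, derivative_rescale, map_neg, hC, hd2, derivative_one]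
      ring
    · simp [constantCoeff_sin, constantCoeff_cos, constantCoeff_rescale]
  have h3 : (2 * sin ℚ * cos ℚ) ^ 2 + (cos ℚ ^ 2 - sin ℚ ^ 2) ^ 2 = 1 := by
    linear_combination (sin ℚ ^ 2 + cos ℚ ^ 2 + 1) * sin_sq_add_cos_sq
  constructor
  · linear_combination (cos ℚ ^ 2 - sin ℚ ^ 2) * h1 + (2 * sin ℚ * cos ℚ) * h2 -
      rescale 2 (sin ℚ) * h3
  · linear_combination (cos ℚ ^ 2 - sin ℚ ^ 2) * h2 - (2 * sin ℚ * cos ℚ) * h1 -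
      rescale 2 (cos ℚ) * h3

theorem sin_cos_eq_half_angle :
    sin ℚ = 2 * rescale (1 / 2) (sin ℚ) * rescale (1 / 2) (cos ℚ) ∧
    1 - cos ℚ = 2 * rescale (1 / 2) (sin ℚ) ^ 2 := by
  have hid : ∀ f : PowerSeries ℚ, rescale (1 / 2) (rescale 2 f) = f := fun f => by
    rw [rescale_rescale]
    norm_num
  have h1 := congrArg (rescale (1 / 2 : ℚ)) rescale_two_sin_cos.1
  have h2 := congrArg (rescale (1 / 2 : ℚ)) rescale_two_sin_cos.2
  have h3 := congrArg (rescale (1 / 2 : ℚ)) sin_sq_add_cos_sq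
  simp only [hid, map_mul, map_ofNat, map_sub, map_add, map_pow, map_one] at h1 h2 h3
  exact ⟨h1, by linear_combination -h2 - h3⟩

theorem two_powerSeries_ne_zero : (2 : PowerSeries ℚ) ≠ 0 := by
  intro h
  have := congrArg (constantCoeff (R := ℚ)) h
  rw [map_ofNat, map_zero] at this
  exact two_ne_zero this

theorem sin_ne_zero : sin ℚ ≠ 0 := by
  intro h
  have := congrArg (constantCoeff (R := ℚ)) derivative_sin
  rw [h, map_zero, map_zero, constantCoeff_cos] at this
  exact zero_ne_one this

theorem cos_ne_zero : cos ℚ ≠ 0 := by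
  intro h
  have := constantCoeff_cos
  rw [h, map_zero] at this
  exact zero_ne_one this

theorem rescale_half_sin_ne_zero : rescale (1 / 2) (sin ℚ) ≠ 0 := by
  intro h
  have := sin_cos_eq_half_angle.1
  rw [h, mul_zero, zero_mul] at this
  exact sin_ne_zero this

theorem rescale_half_cos_ne_zero : rescale (1 / 2) (cos ℚ) ≠ 0 := by
  intro h
  have := sin_cos_eq_half_angle.1
  rw [h, mul_zero] at this
  exact sin_ne_zero this

end Trigonometry

/-! ### Generating functions and comparison of coefficients -/

section GeneratingFunctions

open PowerSeries

theorem expand_trigTail_zero : expand 2 two_ne_zero (trigTail 0) = cos ℚ := by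
  ext n
  rw [coeff_expand, trigTail, coeff_mk, cos, coeff_mk]
  simp only [even_iff_two_dvd, Algebra.algebraMap_self, RingHom.id_apply, add_zero]
  split_ifs with h
  · rw [Nat.mul_div_cancel' h]
  · rfl

theorem X_mul_expand_trigTail_one : X * expand 2 two_ne_zero (trigTail 1) = sin ℚ := by
  ext n
  rcases n with _ | n
  · rw [coeff_zero_X_mul, coeff_zero_eq_constantCoeff_apply, constantCoeff_sin]
  · rw [coeff_succ_X_mul, coeff_expand, trigTail, coeff_mk, sin, coeff_mk]
    simp only [even_iff_two_dvd, Algebra.algebraMap_self, RingHom.id_apply]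
    by_cases h : 2 ∣ n
    · rw [if_pos h, if_neg (by omega), Nat.mul_div_cancel' h, show (n + 1) / 2 = n / 2 by omega]
    · rw [if_neg h, if_pos (by omega)]

theorem trigTail_eq (a : ℕ) : trigTail a = C ((a.factorial : ℚ)⁻¹) - X * trigTail (a + 2) := by
  ext n
  rcases n with _ | n
  · simp [trigTail]
  · rw [map_sub, coeff_succ_X_mul, coeff_C, if_neg n.succ_ne_zero, trigTail, trigTail, coeff_mk,
      coeff_mk, show 2 * (n + 1) + a = 2 * n + (a + 2) by ring]
    ring

theorem X_sq_mul_expand_trigTail_two :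
    X ^ 2 * expand 2 two_ne_zero (trigTail 2) = 1 - cos ℚ := by
  rw [← expand_trigTail_zero, trigTail_eq 0]
  simp only [map_sub, map_mul, expand_X, expand_C]
  simp

theorem X_pow_three_mul_expand_trigTail_three :
    X ^ 3 * expand 2 two_ne_zero (trigTail 3) = X - sin ℚ := by
  rw [← X_mul_expand_trigTail_one, trigTail_eq 1]
  simp only [map_sub, map_mul, expand_X, expand_C]
  simp
  ring

theorem evenSeries_eq (c : ℕ → ℚ) (G : PowerSeries ℚ) (h : ∀ m, c (m + 1) = coeff m G) :
    evenSeries c = X ^ 2 * expand 2 two_ne_zero G := by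
  ext n
  rw [evenSeries, coeff_mk, coeff_X_pow_mul']
  rcases lt_or_ge n 2 with hn | hn
  · rw [if_neg (by omega : ¬ 2 ≤ n), if_neg]
    rintro ⟨⟨k, rfl⟩, h2⟩
    omega
  · obtain ⟨m, rfl⟩ := Nat.exists_eq_add_of_le' hn
    rw [if_pos hn, Nat.add_sub_cancel, coeff_expand]
    by_cases hm : 2 ∣ m
    · obtain ⟨k, rfl⟩ := hm
      rw [if_pos ⟨⟨k + 1, by ring⟩, by omega⟩, if_pos ⟨k, rfl⟩,
        show (2 * k + 2) / 2 = k + 1 by omega, h]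
      simp
    · rw [if_neg hm, if_neg]
      rintro ⟨⟨k, hk⟩, -⟩
      omega

theorem expand_quotient_mul (a b : ℕ) :
    expand 2 two_ne_zero ((trigTail a)⁻¹ * trigTail b) * expand 2 two_ne_zero (trigTail a) =
      expand 2 two_ne_zero (trigTail b) := by
  rw [← map_mul, mul_right_comm, trigTail_inv_mul, one_mul]

/-- The power series of the tangent. -/
theorem tangentSeries_mul_cos :
    X * expand 2 two_ne_zero ((trigTail 0)⁻¹ * trigTail 1) * cos ℚ = sin ℚ := by
  rw [← expand_trigTail_zero, ← X_mul_expand_trigTail_one, mul_assoc, expand_quotient_mul]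

theorem X_sq_mul_quotient_mul_sin :
    X ^ 2 * expand 2 two_ne_zero ((trigTail 1)⁻¹ * trigTail 2) * sin ℚ = X * (1 - cos ℚ) := by
  have h := expand_quotient_mul 1 2
  rw [← X_mul_expand_trigTail_one, ← X_sq_mul_expand_trigTail_two]
  linear_combination X ^ 3 * h

theorem X_sq_mul_quotient_three_mul_sin :
    X ^ 2 * expand 2 two_ne_zero ((trigTail 1)⁻¹ * trigTail 3) * sin ℚ = X - sin ℚ := by
  have h := expand_quotient_mul 1 3
  rw [← X_pow_three_mul_expand_trigTail_three, ← X_mul_expand_trigTail_one]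
  linear_combination X ^ 3 * h

theorem X_sq_mul_quotient_mul_half_cos :
    X ^ 2 * expand 2 two_ne_zero ((trigTail 1)⁻¹ * trigTail 2) * rescale (1 / 2) (cos ℚ) =
      X * rescale (1 / 2) (sin ℚ) := by
  have h := X_sq_mul_quotient_mul_sin
  obtain ⟨h1, h2⟩ := sin_cos_eq_half_angle
  rw [h2] at h
  nth_rewrite 1 [h1] at h
  have h3 : (2 : PowerSeries ℚ) * rescale (1 / 2) (sin ℚ) ≠ 0 :=
    mul_ne_zero two_powerSeries_ne_zero rescale_half_sin_ne_zero
  refine mul_left_cancel₀ h3 ?_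
  linear_combination h

/-- After $z=X^2$ the left quotient becomes $\tan(X/2)/X$ and the right one $\tan(X)/X$; the power
of $2$ comes from rescaling the coefficient of $X^{2m+1}$ in the tangent. -/
theorem coeff_quotient_one_two (m : ℕ) : coeff m ((trigTail 1)⁻¹ * trigTail 2) =
    coeff m ((trigTail 0)⁻¹ * trigTail 1) / 2 ^ (2 * m + 1) := by
  have h1 : X ^ 2 * expand 2 two_ne_zero ((trigTail 1)⁻¹ * trigTail 2) =
      X * rescale (1 / 2) (X * expand 2 two_ne_zero ((trigTail 0)⁻¹ * trigTail 1)) := by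
    refine mul_right_cancel₀ rescale_half_cos_ne_zero ?_
    rw [X_sq_mul_quotient_mul_half_cos, mul_assoc, ← map_mul, tangentSeries_mul_cos]
  have h2 := congrArg (coeff (2 * m + 2)) h1
  rw [coeff_X_pow_mul, coeff_expand_mul, coeff_succ_X_mul, coeff_rescale, coeff_succ_X_mul,
    coeff_expand_mul] at h2
  rw [h2, one_div, inv_pow, div_eq_inv_mul]

theorem coeff_quotient_one_three (m : ℕ) :
    (2 ^ (2 * m + 2) - 1) * coeff m ((trigTail 1)⁻¹ * trigTail 3) =
      (2 ^ (2 * m + 1) - 1) * coeff m ((trigTail 1)⁻¹ * trigTail 2) := by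
  set F := X ^ 2 * expand 2 two_ne_zero ((trigTail 1)⁻¹ * trigTail 2) with hF
  set G := X ^ 2 * expand 2 two_ne_zero ((trigTail 1)⁻¹ * trigTail 3) with hG
  have hFs : F * sin ℚ = X * (1 - cos ℚ) := X_sq_mul_quotient_mul_sin
  have hGs : G * sin ℚ = X - sin ℚ := X_sq_mul_quotient_three_mul_sin
  have hC : (C (2 : ℚ) : PowerSeries ℚ) = 2 := map_ofNat C 2
  have hF2 := congrArg (rescale (2 : ℚ)) hFs
  have hG2 := congrArg (rescale (2 : ℚ)) hGs
  simp only [map_mul, map_sub, map_one, rescale_X, hC, rescale_two_sin_cos.1,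
    rescale_two_sin_cos.2] at hF2 hG2
  -- Here $F=X(1-\cos X)/\sin X$ and $G=X/\sin X-1$. By the double-angle formulas both sides equal
  -- $2X(1-\cos X)/(\sin X\cos X)$, so multiplying by $2\sin X\cos X$ clears all denominators.
  have key : 2 * (rescale 2 G - G) = rescale 2 F - 2 * F := by
    refine mul_right_cancel₀ (mul_ne_zero (mul_ne_zero two_powerSeries_ne_zero sin_ne_zero) cos_ne_zero) ?_
    linear_combination 2 * hG2 - 4 * cos ℚ * hGs - hF2 + 4 * cos ℚ * hFs -
      2 * X * sin_sq_add_cos_sq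
  have h2 := congrArg (coeff (2 * m + 2)) key
  rw [← hC] at h2
  simp only [coeff_C_mul, map_sub, coeff_rescale, hF, hG, coeff_X_pow_mul, coeff_expand_mul] at h2
  rw [pow_succ 2 (2 * m + 1)] at h2 ⊢
  linear_combination h2 / 2

theorem natCast_factorial_ne_zero (k : ℕ) : (k.factorial : ℚ) ≠ 0 :=
  Nat.cast_ne_zero.2 (Nat.factorial_ne_zero k)

theorem strip_formulas (n : ℕ) (hn : 1 ≤ n) :
      (fSigma2 n : ℚ) =
          (Nat.factorial (3 * n - 2) : ℚ) * (eulerNumber (2 * n - 1) : ℚ) /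
            ((Nat.factorial (2 * n - 1) : ℚ) * 2 ^ (2 * n - 2)) ∧
      (fSigma1 n : ℚ) =
          (Nat.factorial (3 * n - 1) : ℚ) * (eulerNumber (2 * n - 1) : ℚ) /
            ((Nat.factorial (2 * n - 1) : ℚ) * 2 ^ (2 * n - 1)) ∧
      (fSigma0 n : ℚ) =
          (Nat.factorial (3 * n) : ℚ) * ((2 : ℚ) ^ (2 * n - 1) - 1) *
              (eulerNumber (2 * n - 1) : ℚ) /
            ((Nat.factorial (2 * n - 1) : ℚ) * 2 ^ (2 * n - 1) * ((2 : ℚ) ^ (2 * n) - 1)) := by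
  obtain ⟨m, rfl⟩ := Nat.exists_eq_add_of_le' hn
  have e1 : 3 * (m + 1) - 2 = 3 * m + 1 := by omega
  have e2 : 3 * (m + 1) - 1 = 3 * m + 2 := by omega
  have e3 : 3 * (m + 1) = 3 * m + 3 := by omega
  have e4 : 2 * (m + 1) - 1 = 2 * m + 1 := by omega
  have e5 : 2 * (m + 1) - 2 = 2 * m := by omega
  have e6 : 2 * (m + 1) = 2 * m + 2 := by omega
  rw [e1, e2, e4, e5, e3, e6, fSigma2_eq_coeff, fSigma1_eq_coeff, fSigma0_eq_coeff,
    eulerNumber_eq_coeff]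
  have h1 := coeff_quotient_one_two m
  have h2 := coeff_quotient_one_three m
  have h3 := natCast_factorial_ne_zero (2 * m + 1)
  have h4 : (2 : ℚ) ^ (2 * m + 2) - 1 ≠ 0 :=
    (sub_pos.2 (one_lt_pow₀ one_lt_two (by omega))).ne'
  refine ⟨?_, ?_, ?_⟩
  · rw [h1]
    field_simp
    ring
  · rw [h1]
    field_simp
  · rw [h1] at h2
    rw [eq_div_iff (mul_ne_zero (mul_ne_zero h3 (by positivity)) h4)]
    field_simp at h2
    linear_combination ((3 * m + 3).factorial : ℚ) * (2 * m + 1).factorial * h2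

theorem coe_evenSeries_fSigma1 :
    ((evenSeries
          (fun n => (fSigma1 n : ℚ) / (Nat.factorial (3 * n - 1) : ℚ)) :
          PowerSeries ℚ) : LaurentSeries ℚ) =
      ((X : PowerSeries ℚ) : LaurentSeries ℚ) *
        (((rescale (1 / 2 : ℚ) (sin ℚ) : PowerSeries ℚ) :
            LaurentSeries ℚ) /
          ((rescale (1 / 2 : ℚ) (cos ℚ) : PowerSeries ℚ) :
            LaurentSeries ℚ)) := by
  have h : evenSeries (fun n => (fSigma1 n : ℚ) / (Nat.factorial (3 * n - 1) : ℚ)) =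
      X ^ 2 * expand 2 two_ne_zero ((trigTail 1)⁻¹ * trigTail 2) :=
    evenSeries_eq _ _ fun m => by
      rw [fSigma1_eq_coeff, show 3 * (m + 1) - 1 = 3 * m + 2 by omega,
        mul_div_cancel_left₀ _ (natCast_factorial_ne_zero _)]
  have hcos : ((rescale (1 / 2 : ℚ) (cos ℚ) : PowerSeries ℚ) : LaurentSeries ℚ) ≠ 0 :=
    fun h0 => rescale_half_cos_ne_zero
      (HahnSeries.ofPowerSeries_injective (h0.trans (map_zero _).symm))
  rw [h, mul_div_assoc', eq_div_iff hcos, ← PowerSeries.coe_mul, ← PowerSeries.coe_mul,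
    X_sq_mul_quotient_mul_half_cos]

theorem coe_evenSeries_fSigma0 :
    ((evenSeries
          (fun n => (fSigma0 n : ℚ) / (Nat.factorial (3 * n) : ℚ)) :
          PowerSeries ℚ) : LaurentSeries ℚ) =
      ((X : PowerSeries ℚ) : LaurentSeries ℚ) /
          ((sin ℚ : PowerSeries ℚ) : LaurentSeries ℚ) - 1 := by
  have h : evenSeries (fun n => (fSigma0 n : ℚ) / (Nat.factorial (3 * n) : ℚ)) =
      X ^ 2 * expand 2 two_ne_zero ((trigTail 1)⁻¹ * trigTail 3) :=
    evenSeries_eq _ _ fun m => by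
      rw [fSigma0_eq_coeff, show 3 * (m + 1) = 3 * m + 3 by omega,
        mul_div_cancel_left₀ _ (natCast_factorial_ne_zero _)]
  have hsin : ((sin ℚ : PowerSeries ℚ) : LaurentSeries ℚ) ≠ 0 :=
    fun h0 => sin_ne_zero (HahnSeries.ofPowerSeries_injective (h0.trans (map_zero _).symm))
  rw [h, eq_sub_iff_add_eq, eq_div_iff hsin, add_mul, one_mul, ← PowerSeries.coe_mul,
    ← PowerSeries.coe_add, X_sq_mul_quotient_three_mul_sin, sub_add_cancel]

end GeneratingFunctions

end ThreeStrip

theorem theorem1 :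
    (∀ n : ℕ, 1 ≤ n →
      (ThreeStrip.fSigma2 n : ℚ) =
          (Nat.factorial (3 * n - 2) : ℚ) * (ThreeStrip.eulerNumber (2 * n - 1) : ℚ) /
            ((Nat.factorial (2 * n - 1) : ℚ) * 2 ^ (2 * n - 2)) ∧
      (ThreeStrip.fSigma1 n : ℚ) =
          (Nat.factorial (3 * n - 1) : ℚ) * (ThreeStrip.eulerNumber (2 * n - 1) : ℚ) /
            ((Nat.factorial (2 * n - 1) : ℚ) * 2 ^ (2 * n - 1)) ∧
      (ThreeStrip.fSigma0 n : ℚ) =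
          (Nat.factorial (3 * n) : ℚ) * ((2 : ℚ) ^ (2 * n - 1) - 1) *
              (ThreeStrip.eulerNumber (2 * n - 1) : ℚ) /
            ((Nat.factorial (2 * n - 1) : ℚ) * 2 ^ (2 * n - 1) * ((2 : ℚ) ^ (2 * n) - 1))) ∧
    -- the generating functions, as identities in the field of formal Laurent series over `ℚ`
    ((ThreeStrip.evenSeries
          (fun n => (ThreeStrip.fSigma1 n : ℚ) / (Nat.factorial (3 * n - 1) : ℚ)) :
          PowerSeries ℚ) : LaurentSeries ℚ) =
      ((PowerSeries.X : PowerSeries ℚ) : LaurentSeries ℚ) *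
        (((PowerSeries.rescale (1 / 2 : ℚ) (PowerSeries.sin ℚ) : PowerSeries ℚ) :
            LaurentSeries ℚ) /
          ((PowerSeries.rescale (1 / 2 : ℚ) (PowerSeries.cos ℚ) : PowerSeries ℚ) :
            LaurentSeries ℚ)) ∧
    ((ThreeStrip.evenSeries
          (fun n => (ThreeStrip.fSigma0 n : ℚ) / (Nat.factorial (3 * n) : ℚ)) :
          PowerSeries ℚ) : LaurentSeries ℚ) =
      ((PowerSeries.X : PowerSeries ℚ) : LaurentSeries ℚ) /
          ((PowerSeries.sin ℚ : PowerSeries ℚ) : LaurentSeries ℚ) - 1 :=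
  ⟨ThreeStrip.strip_formulas, ThreeStrip.coe_evenSeries_fSigma1,
    ThreeStrip.coe_evenSeries_fSigma0⟩
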